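/- Let $X$ be a connected, locally path connected space, let $x_0\in X$, and suppose that $X$ is strong SLT at $x_0$: for every $x\in X$ and every neighbourhood $U$ of $x_0$ there is a neighbourhood $V$ of $x$ such that, for every path $\alpha$ from $x_0$ to $x$ and every loop $\beta$ in $V$ based at $x$, the loop $\alpha*\beta*\alpha^{-1}$ is homotopic relative to its endpoints to a loop in $U$ based at $x_0$. A pointed continuous map $p:(\widetilde X,\tilde x_0)\to(X,x_0)$ is called a generalized covering if $\widetilde X$ is connected and locally path connected and $p$ has the unique lifting property: for every connected, locally path connected pointed space $(Y,y_0)$ and every continuous $f:(Y,y_0)\to(X,x_0)$ with $f_*\pi_1(Y,y_0)\subseteq p_*\pi_1(\widetilde X,\tilde x_0)$ there is a unique continuous $\tilde f:(Y,y_0)\to(\widetilde X,\tilde x_0)$ with $p\circ\tilde f=f$. A subgroup $K\le\pi_1(X,x_0)$ is called a covering subgroup if $K=q_*\pi_1(E,e_0)$ for some covering map $q:(E,e_0)\to(X,x_0)$ with $E$ connected. Then for every subgroup $H\le\pi_1(X,x_0)$ the following are equivalent: 1. there is a generalized covering $p:(\widetilde X,\tilde x_0)\to(X,x_0)$ with $p_*\pi_1(\widetilde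 X,\tilde x_0)=H$; 2. $H$ is the intersection of a (nonempty) family of covering subgroups of $\pi_1(X,x_0)$. -/

import Mathlib

universe u

/-- The space `X` is a strong small loop transfer space at `x₀`: for every point `x` and every
neighbourhood `U` of `x₀` there is one neighbourhood `V` of `x` such that for every path `α` from
`x₀` to `x` and every loop `β` in `V` based at `x`, the loop `α * β * α⁻¹` is homotopic, relative
to the endpoints, to a loop in `U` based at `x₀`. -/
def StrongSLTAt (X : Type u) [TopologicalSpace X] (x₀ : X) : Prop :=
  ∀ x : X, ∀ U ∈ nhds x₀, ∃ V ∈ nhds x, ∀ (α : Path x₀ x) (β : Path x x),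
    Set.range β ⊆ V →
      ∃ γ : Path x₀ x₀, Set.range γ ⊆ U ∧ Path.Homotopic γ ((α.trans β).trans α.symm)

/-- The pointed map `p : (E, e₀) → (X, x₀)` has the unique lifting property: every pointed map
`f : (Y, y₀) → (X, x₀)` from a connected, locally path connected space with
`f_* π₁(Y, y₀) ⊆ p_* π₁(E, e₀)` has exactly one continuous lift `(Y, y₀) → (E, e₀)`. -/
def HasUniqueLiftingProperty {X E : Type u} [TopologicalSpace X] [TopologicalSpace E]
    (p : C(E, X)) (e₀ : E) (x₀ : X) (hp : p e₀ = x₀) : Prop :=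
  ∀ (Y : Type u) [TopologicalSpace Y] [ConnectedSpace Y] [LocallyPathConnectedSpace Y]
    (y₀ : Y) (f : C(Y, X)) (hf : f y₀ = x₀),
    (FundamentalGroup.mapOfEq f hf).range ≤ (FundamentalGroup.mapOfEq p hp).range →
      ∃! g : C(Y, E), g y₀ = e₀ ∧ p.comp g = f

/-- The pointed map `p : (E, e₀) → (X, x₀)` is a generalized covering map: `E` is connected and
locally path connected, and `p` has the unique lifting property. -/
structure IsGeneralizedCovering {X E : Type u} [TopologicalSpace X] [TopologicalSpace E]
    (p : C(E, X)) (e₀ : E) (x₀ : X) (hp : p e₀ = x₀) : Prop where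
  connectedSpace : ConnectedSpace E
  locallyPathConnectedSpace : LocallyPathConnectedSpace E
  uniqueLifting : HasUniqueLiftingProperty p e₀ x₀ hp

/-- The subgroup `K` of `π₁(X, x₀)` is a covering subgroup: it is `p_* π₁(E, e₀)` for some
covering map `p : (E, e₀) → (X, x₀)` with `E` connected. -/
def IsCoveringSubgroup {X : Type u} [TopologicalSpace X] (x₀ : X)
    (K : Subgroup (FundamentalGroup X x₀)) : Prop :=
  ∃ (E : Type u) (_ : TopologicalSpace E) (p : C(E, X)) (e₀ : E) (hp : p e₀ = x₀),
    ConnectedSpace E ∧ IsCoveringMap p ∧ (FundamentalGroup.mapOfEq p hp).range = K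

/-! Both directions rest on the whisker space of a subgroup `K`. If `K` absorbs small loops, its
projection is a covering with group `K` (`isCoveringMap_proj`, `range_projMap_of_absorbs`);
conversely covering subgroups absorb small loops.

If `H` is an intersection of such `K`, the whisker space of `H` maps to that of each `K`, and points
in one fibre are separated by these maps. Unique lifting and the value of the fundamental group are
thus inherited from honest coverings.

If `H` comes from a generalized covering, let `N_U` be the normal core of the subgroup of classes of
loops in a neighbourhood `U` of `x₀`. Strong SLT makes `N_U`, hence `H ⊔ N_U`, absorb small loops.
The crux is that these joins intersect in `H`: for a class in all of them, the lift of a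
representative ends at a point `e₁` reachable from `e₀` by lifts of arbitrarily small loops. All
paths from `e₀` to `e₁` are assembled into one contractible comb whose arcs are as short as their
images in `X`; continuity of the lifted comb map forces `e₁ = e₀` (`eq_of_small_paths`). -/

open Set Filter Topology unitInterval

/-! ### Algebra of path classes. -/

namespace Path.Homotopic.Quotient

variable {X : Type*} [TopologicalSpace X] {x y z : X}

theorem symm_symm (a : Path.Homotopic.Quotient x y) : a.symm.symm = a := by
  induction a using Path.Homotopic.Quotient.ind with | _ a =>
  simp only [← mk_symm, Path.symm_symm]

theorem symm_trans_rev (a : Path.Homotopic.Quotient x y) (b : Path.Homotopic.Quotient y z) :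
    (a.trans b).symm = b.symm.trans a.symm := by
  induction a using Path.Homotopic.Quotient.ind with | _ a =>
  induction b using Path.Homotopic.Quotient.ind with | _ b =>
  simp only [← mk_trans, ← mk_symm, Path.trans_symm]

theorem trans_symm_trans (a : Path.Homotopic.Quotient x y) (b : Path.Homotopic.Quotient x z) :
    a.trans (a.symm.trans b) = b := by
  rw [← trans_assoc, trans_symm, refl_trans]

theorem symm_trans_trans (a : Path.Homotopic.Quotient x y) (b : Path.Homotopic.Quotient y z) :
    a.symm.trans (a.trans b) = b := by
  rw [← trans_assoc, symm_trans, refl_trans]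

end Path.Homotopic.Quotient

noncomputable section

variable {X : Type u} [TopologicalSpace X] {x₀ y z : X}

/-- The class in `π₁(X, x₀)` of the loop `a * b⁻¹`. -/
def loopClass (a b : Path x₀ y) : FundamentalGroup X x₀ :=
  (Path.Homotopic.Quotient.mk a).trans (Path.Homotopic.Quotient.mk b).symm

open Path.Homotopic.Quotient

theorem loopClass_self (a : Path x₀ y) : loopClass a a = 1 := trans_symm _

theorem loopClass_inv (a b : Path x₀ y) : (loopClass a b)⁻¹ = loopClass b a := by
  rw [loopClass, FundamentalGroup.inv_def, symm_trans_rev, Path.Homotopic.Quotient.symm_symm,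
    loopClass]

theorem loopClass_mul (a b c : Path x₀ y) : loopClass b c * loopClass a b = loopClass a c := by
  simp only [loopClass, FundamentalGroup.mul_def, trans_assoc, symm_trans_trans]

theorem loopClass_trans_trans (a b : Path x₀ y) (ρ : Path y z) :
    loopClass (a.trans ρ) (b.trans ρ) = loopClass a b := by
  simp only [loopClass, mk_trans, symm_trans_rev, trans_assoc, trans_symm_trans]

theorem loopClass_congr {a a' b b' : Path x₀ y} (ha : a.Homotopic a') (hb : b.Homotopic b') :
    loopClass a b = loopClass a' b' := by
  rw [loopClass, loopClass, eq.2 ha, eq.2 hb]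

theorem loopClass_refl (a : Path x₀ x₀) :
    loopClass a (Path.refl x₀) = Path.Homotopic.Quotient.mk a := by
  rw [loopClass, ← mk_symm, Path.refl_symm, mk_refl, trans_refl]

end

/-! ### The whisker space of a subgroup. -/

noncomputable section

instance unitInterval.locallyPathConnectedSpace : LocallyPathConnectedSpace I :=
  (convex_Icc 0 1).locallyPathConnectedSpace

/-- Paths issuing from `x₀`, identified when they have the same endpoint and differ by an element
of `H`. -/
def whiskerSetoid {X : Type u} [TopologicalSpace X] {x₀ : X}
    (H : Subgroup (FundamentalGroup X x₀)) : Setoid (Σ y, Path x₀ y) where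
  r a b := ∃ h : a.1 = b.1, loopClass (a.2.cast rfl h.symm) b.2 ∈ H
  iseqv :=
    { refl := fun a => ⟨rfl, by
        rw [Path.cast_rfl_rfl, loopClass_self]; exact H.one_mem⟩
      symm := by
        rintro ⟨y, a⟩ ⟨z, b⟩ ⟨h₀, h⟩
        obtain rfl : y = z := h₀
        refine ⟨rfl, ?_⟩
        rw [← loopClass_inv]
        exact H.inv_mem h
      trans := by
        rintro ⟨y, a⟩ ⟨z, b⟩ ⟨w, c⟩ ⟨h₀, h⟩ ⟨h₁, h'⟩
        obtain rfl : y = z := h₀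
        obtain rfl : y = w := h₁
        refine ⟨rfl, ?_⟩
        dsimp only [Path.cast_rfl_rfl] at h h' ⊢
        rw [← loopClass_mul _ b]
        exact H.mul_mem h' h }

/-- The space of classes modulo `H` of paths issuing from `x₀`, with the whisker topology. -/
def WhiskerSpace {X : Type u} [TopologicalSpace X] {x₀ : X}
    (H : Subgroup (FundamentalGroup X x₀)) : Type u :=
  Quotient (whiskerSetoid H)

namespace WhiskerSpace

variable {X : Type u} [TopologicalSpace X] {x₀ : X} {H K : Subgroup (FundamentalGroup X x₀)}

/-- The class modulo `H` of a path issuing from `x₀`. -/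
def mk (H : Subgroup (FundamentalGroup X x₀)) {y : X} (a : Path x₀ y) : WhiskerSpace H :=
  Quotient.mk (whiskerSetoid H) ⟨y, a⟩

theorem exists_rep (z : WhiskerSpace H) : ∃ (y : X) (a : Path x₀ y), z = mk H a := by
  obtain ⟨⟨y, a⟩, rfl⟩ := Quotient.exists_rep z
  exact ⟨y, a, rfl⟩

theorem mk_eq_mk_iff {y : X} {a b : Path x₀ y} : mk H a = mk H b ↔ loopClass a b ∈ H :=
  Quotient.eq.trans ⟨fun ⟨_, h⟩ => h, fun h => ⟨rfl, h⟩⟩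

theorem mk_eq_of_homotopic {y : X} {a b : Path x₀ y} (h : a.Homotopic b) : mk H a = mk H b := by
  rw [mk_eq_mk_iff, loopClass_congr h (.refl b), loopClass_self]
  exact H.one_mem

theorem mk_trans_eq_mk_trans_iff {y z : X} {a b : Path x₀ y} (ρ : Path y z) :
    mk H (a.trans ρ) = mk H (b.trans ρ) ↔ mk H a = mk H b := by
  rw [mk_eq_mk_iff, mk_eq_mk_iff, loopClass_trans_trans]

theorem mk_trans_assoc {w y z : X} (a : Path x₀ w) (ρ : Path w y) (τ : Path y z) :
    mk H ((a.trans ρ).trans τ) = mk H (a.trans (ρ.trans τ)) :=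
  mk_eq_of_homotopic ⟨Path.Homotopy.transAssoc a ρ τ⟩

theorem mk_trans_symm_trans {y z : X} (a : Path x₀ z) (ρ : Path y z) :
    mk H ((a.trans ρ.symm).trans ρ) = mk H a := by
  refine mk_eq_of_homotopic (Path.Homotopic.Quotient.eq.1 ?_)
  simp only [Path.Homotopic.Quotient.mk_trans, Path.Homotopic.Quotient.mk_symm,
    Path.Homotopic.Quotient.trans_assoc, Path.Homotopic.Quotient.symm_trans,
    Path.Homotopic.Quotient.trans_refl]

/-- The endpoint of a class of paths. -/
def proj (H : Subgroup (FundamentalGroup X x₀)) : WhiskerSpace H → X :=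
  Quotient.lift (fun a => a.1) fun _ _ h => h.1

theorem exists_rep_of_proj {z : WhiskerSpace H} {y : X} (h : proj H z = y) :
    ∃ a : Path x₀ y, z = mk H a := by
  obtain ⟨y, a, rfl⟩ := exists_rep z
  subst h
  exact ⟨a, rfl⟩

/-- Defining openness as stability under appending short paths makes continuity of maps out of the
space a check on representatives; that the usual basic sets are open is `isOpen_sheet`. -/
instance : TopologicalSpace (WhiskerSpace H) where
  IsOpen s := ∀ (y : X) (a : Path x₀ y), mk H a ∈ s →
    ∃ U ∈ 𝓝 y, ∀ (z : X) (ρ : Path y z), range ρ ⊆ U → mk H (a.trans ρ) ∈ s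
  isOpen_univ _ _ _ := ⟨univ, univ_mem, fun _ _ _ => mem_univ _⟩
  isOpen_inter s t hs ht y a ha := by
    obtain ⟨U, hU, h⟩ := hs y a ha.1
    obtain ⟨V, hV, h'⟩ := ht y a ha.2
    exact ⟨U ∩ V, inter_mem hU hV, fun z ρ hρ =>
      ⟨h z ρ (hρ.trans inter_subset_left), h' z ρ (hρ.trans inter_subset_right)⟩⟩
  isOpen_sUnion S hS y a ha := by
    obtain ⟨s, hs, ha⟩ := ha
    obtain ⟨U, hU, h⟩ := hS s hs y a ha
    exact ⟨U, hU, fun z ρ hρ => ⟨s, hs, h z ρ hρ⟩⟩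

theorem continuous_proj : Continuous (proj H) where
  isOpen_preimage W hW _ _ ha :=
    ⟨W, hW.mem_nhds ha, fun _ ρ hρ => hρ ⟨1, ρ.target⟩⟩

/-- The classes obtained from `a` by appending a path in `V`. -/
def sheet (H : Subgroup (FundamentalGroup X x₀)) {x : X} (a : Path x₀ x) (V : Set X) :
    Set (WhiskerSpace H) :=
  {w | ∃ (z : X) (ρ : Path x z), range ρ ⊆ V ∧ w = mk H (a.trans ρ)}

theorem mk_mem_sheet {x : X} (a : Path x₀ x) {V : Set X} (hx : x ∈ V) : mk H a ∈ sheet H a V :=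
  ⟨x, Path.refl x, by simpa using hx, mk_eq_of_homotopic ⟨(Path.Homotopy.transRefl a).symm⟩⟩

theorem isOpen_sheet {x : X} (a : Path x₀ x) {V : Set X} (hV : IsOpen V) :
    IsOpen (sheet H a V) := by
  rintro y b ⟨z, ρ, hρ, hb⟩
  obtain rfl : y = z := congrArg (proj H) hb
  refine ⟨V, hV.mem_nhds (hρ ⟨1, ρ.target⟩), fun w τ hτ => ⟨w, ρ.trans τ, ?_, ?_⟩⟩
  · rw [Path.trans_range]
    exact union_subset hρ hτ
  · rw [← mk_trans_assoc, mk_trans_eq_mk_trans_iff, hb]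

/-- The initial segment of `b` of length `t`. -/
def initialSegment {x y : X} (b : Path x y) (t : I) : Path x (b t) :=
  (b.subpath 0 t).cast b.source.symm rfl

theorem mk_trans_initialSegment_trans {x y : X} (a : Path x₀ x) (b : Path x y) (s t : I) :
    mk H ((a.trans (initialSegment b s)).trans (b.subpath s t)) =
      mk H (a.trans (initialSegment b t)) := by
  rw [mk_trans_assoc]
  have h : Path.Homotopic _ _ := ⟨Path.Homotopy.subpathTransSubpath b 0 s t⟩
  exact mk_eq_of_homotopic ((Path.Homotopic.refl a).hcomp (h.pathCast b.source.symm rfl))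

theorem mk_trans_initialSegment_zero {x y : X} (a : Path x₀ x) (b : Path x y) :
    mk H (a.trans (initialSegment b 0)) = mk H a := by
  have : ∀ (z : X) (h : z = x) (c : Path x z), (∀ t, c t = x) → mk H (a.trans c) = mk H a := by
    rintro z rfl c hc
    obtain rfl : c = Path.refl z := Path.ext (funext hc)
    exact mk_eq_of_homotopic ⟨Path.Homotopy.transRefl a⟩
  exact this _ b.source _ fun t => by simp [initialSegment]

theorem mk_eq_mk_refl {y : X} (a : Path x₀ y) (h : ∀ t, a t = x₀) :
    mk H a = mk H (Path.refl x₀) := by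
  obtain rfl : y = x₀ := a.target.symm.trans (h 1)
  obtain rfl : a = Path.refl y := Path.ext (funext h)
  rfl

theorem mk_trans_initialSegment_one {x y : X} (a : Path x₀ x) (b : Path x y) :
    mk H (a.trans (initialSegment b 1)) = mk H (a.trans b) := by
  have : ∀ (z : X) (h : z = y) (c : Path x z), (∀ t, c t = b t) →
      mk H (a.trans c) = mk H (a.trans b) := by
    rintro z rfl c hc
    obtain rfl : c = b := Path.ext (funext hc)
    rfl
  exact this _ b.target _ fun t => by simp [initialSegment]

theorem continuous_mk_trans_initialSegment {x y : X} (a : Path x₀ x) (b : Path x y) :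
    Continuous fun t => mk H (a.trans (initialSegment b t)) where
  isOpen_preimage s hs := by
    rw [isOpen_iff_mem_nhds]
    intro t ht
    obtain ⟨U, hU, h⟩ := hs _ _ ht
    -- An interval around `t` mapped into `U`: passing from `t` to `t'` in it appends a subpath of
    -- `b` lying in `U`.
    obtain ⟨J, ⟨hJ, htJ, hJc⟩, hJU⟩ :=
      (LocallyConnectedSpace.open_connected_basis t).mem_iff.1 (b.continuous.continuousAt hU)
    filter_upwards [hJ.mem_nhds htJ] with t' ht'
    rw [mem_preimage, ← mk_trans_initialSegment_trans a b t t']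
    refine h _ _ ?_
    rw [Path.range_subpath]
    exact image_subset_iff.2
      ((hJc.isPreconnected.ordConnected.uIcc_subset htJ ht').trans hJU)

/-- The path in `WhiskerSpace H` formed by appending to `a` the initial segments of `b`. -/
def extend (H : Subgroup (FundamentalGroup X x₀)) {x y : X} (a : Path x₀ x) (b : Path x y) :
    Path (mk H a) (mk H (a.trans b)) where
  toFun t := mk H (a.trans (initialSegment b t))
  continuous_toFun := continuous_mk_trans_initialSegment a b
  source' := mk_trans_initialSegment_zero a b
  target' := mk_trans_initialSegment_one a b

/-- The lift of `a` to `WhiskerSpace H` that starts at the class of the constant path. -/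
def liftPath (H : Subgroup (FundamentalGroup X x₀)) {y : X} (a : Path x₀ y) :
    Path (mk H (Path.refl x₀)) (mk H a) :=
  (extend H (Path.refl x₀) a).cast rfl (mk_eq_of_homotopic ⟨(Path.Homotopy.reflTrans a).symm⟩)

theorem range_initialSegment_subset {x y : X} (b : Path x y) (t : I) :
    range (initialSegment b t) ⊆ range b := by
  have : range (initialSegment b t) = range (b.subpath 0 t) := rfl
  rw [this, Path.range_subpath]
  exact image_subset_range _ _

theorem joinedIn_sheet {x z : X} (a : Path x₀ x) {V : Set X} (ρ : Path x z) (hρ : range ρ ⊆ V) :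
    JoinedIn (sheet H a V) (mk H a) (mk H (a.trans ρ)) :=
  ⟨extend H a ρ, fun t => ⟨_, _, (range_initialSegment_subset ρ t).trans hρ, rfl⟩⟩

instance : PathConnectedSpace (WhiskerSpace H) where
  nonempty := ⟨mk H (Path.refl x₀)⟩
  joined z w := by
    obtain ⟨y, a, rfl⟩ := exists_rep z
    obtain ⟨y, b, rfl⟩ := exists_rep w
    exact ⟨(liftPath H a).symm.trans (liftPath H b)⟩

instance : LocallyPathConnectedSpace (WhiskerSpace H) := by
  rw [locallyPathConnectedSpace_iff_pathComponentIn_mem_nhds]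
  intro w s hs hw
  obtain ⟨x, a, rfl⟩ := exists_rep w
  obtain ⟨U, hU, h⟩ := hs x a hw
  obtain ⟨V, hVU, hV, hxV⟩ := mem_nhds_iff.1 hU
  refine Filter.mem_of_superset ((isOpen_sheet a hV).mem_nhds (mk_mem_sheet a hxV)) ?_
  rintro _ ⟨z, ρ, hρ, rfl⟩
  refine (joinedIn_sheet a ρ hρ).mono ?_
  rintro _ ⟨z', ρ', hρ', rfl⟩
  exact h z' ρ' (hρ'.trans hVU)

/-- The natural map between whisker spaces of nested subgroups. -/
def map (h : H ≤ K) : WhiskerSpace H → WhiskerSpace K :=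
  Quotient.map' (s₁ := whiskerSetoid H) (s₂ := whiskerSetoid K) id fun _ _ ⟨e, he⟩ => ⟨e, h he⟩

theorem map_mk (h : H ≤ K) {y : X} (a : Path x₀ y) : map h (mk H a) = mk K a := rfl

theorem continuous_map (h : H ≤ K) : Continuous (map h) where
  isOpen_preimage _ hs y a ha := hs y a ha

theorem proj_map (h : H ≤ K) (w : WhiskerSpace H) : proj K (map h w) = proj H w := by
  obtain ⟨y, a, rfl⟩ := exists_rep w
  rfl

/-- The endpoint map as a bundled continuous map. -/
def projMap (H : Subgroup (FundamentalGroup X x₀)) : C(WhiskerSpace H, X) :=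
  ⟨proj H, continuous_proj⟩

theorem projMap_mk_refl (H : Subgroup (FundamentalGroup X x₀)) :
    projMap H (mk H (Path.refl x₀)) = x₀ := rfl

/-- The canonical lift of a loop with class in `H` closes up, since its endpoint is the class of
that loop modulo `H`. -/
theorem le_range_projMap :
    H ≤ (FundamentalGroup.mapOfEq (projMap H) (projMap_mk_refl H)).range := by
  intro g hg
  obtain ⟨a, rfl⟩ := Path.Homotopic.Quotient.mk_surjective g
  have h : mk H (Path.refl x₀) = mk H a := by
    rw [eq_comm, mk_eq_mk_iff, loopClass_refl]
    exact hg
  refine ⟨Path.Homotopic.Quotient.mk ((liftPath H a).cast rfl h), ?_⟩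
  rw [FundamentalGroup.mapOfEq_apply]
  rfl

/-! ### Subgroups whose whisker space is a covering. -/

/-- Conjugates of small loops lie in `K`: every point `x` has a neighbourhood whose loops at `x`,
transported to `x₀` along any path, have classes in `K`. -/
def AbsorbsSmallLoops (K : Subgroup (FundamentalGroup X x₀)) : Prop :=
  ∀ x : X, ∃ V ∈ 𝓝 x, ∀ (α : Path x₀ x) (β : Path x x), range β ⊆ V →
    loopClass (α.trans β) α ∈ K

theorem AbsorbsSmallLoops.mono (h : AbsorbsSmallLoops H) (hHK : H ≤ K) : AbsorbsSmallLoops K :=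
  fun x => let ⟨V, hV, hx⟩ := h x; ⟨V, hV, fun α β hβ => hHK (hx α β hβ)⟩

/-- Two paths in `V` with the same ends differ by the loop `ρ * τ⁻¹` in `V`, which `H` absorbs. This
gives both injectivity on sheets and their disjointness. -/
theorem mk_trans_eq_of_absorbs {x z : X} {V : Set X}
    (hV : ∀ (α : Path x₀ x) (β : Path x x), range β ⊆ V → loopClass (α.trans β) α ∈ H)
    {a b : Path x₀ x} (ρ τ : Path x z) (hρ : range ρ ⊆ V) (hτ : range τ ⊆ V) :
    mk H (a.trans ρ) = mk H (b.trans τ) ↔ mk H a = mk H b := by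
  have h : mk H (a.trans ρ) = mk H (a.trans τ) := by
    rw [← mk_trans_eq_mk_trans_iff τ.symm, mk_trans_assoc, mk_trans_assoc]
    have h₁ : mk H (a.trans (ρ.trans τ.symm)) = mk H a := by
      refine mk_eq_mk_iff.2 (hV a _ ?_)
      rw [Path.trans_range, Path.symm_range]
      exact union_subset hρ hτ
    have h₂ : mk H (a.trans (τ.trans τ.symm)) = mk H a := by
      refine mk_eq_mk_iff.2 (hV a _ ?_)
      rw [Path.trans_range, Path.symm_range]
      exact union_subset hτ hτ
    rw [h₁, h₂]
  rw [h, mk_trans_eq_mk_trans_iff]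

theorem isCoveringMap_proj [PathConnectedSpace X] [LocallyPathConnectedSpace X]
    (hH : AbsorbsSmallLoops H) : IsCoveringMap (proj H) := by
  have hbasis : ∀ x : X, ∃ V : Set X, IsOpen V ∧ x ∈ V ∧ IsPathConnected V ∧
      ∀ (α : Path x₀ x) (β : Path x x), range β ⊆ V → loopClass (α.trans β) α ∈ H := by
    intro x
    obtain ⟨U, hU, h⟩ := hH x
    obtain ⟨V, ⟨hV, hxV, hVc⟩, hVU⟩ := (isOpen_isPathConnected_basis x).mem_iff.1 hU
    exact ⟨V, hV, hxV, hVc, fun α β hβ => h α β (hβ.trans hVU)⟩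
  choose V hV hxV hVc hVH using hbasis
  let (x : X) : TopologicalSpace (proj H ⁻¹' {x}) := ⊥
  have (x : X) : DiscreteTopology (proj H ⁻¹' {x}) := ⟨rfl⟩
  have hrep : ∀ x, ∀ i : proj H ⁻¹' {x}, ∃ a : Path x₀ x, i.1 = mk H a :=
    fun x i => exists_rep_of_proj i.2
  choose r hr using hrep
  have (x : X) : Nonempty (proj H ⁻¹' {x}) := ⟨mk H (PathConnectedSpace.somePath x₀ x), rfl⟩
  have : Nonempty (X → WhiskerSpace H) := ⟨fun _ => mk H (Path.refl x₀)⟩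
  have hpath : ∀ x, ∀ z ∈ V x, ∃ ρ : Path x z, range ρ ⊆ V x := fun x z hz => by
    obtain ⟨ρ, hρ⟩ := (hVc x).joinedIn x (hxV x) z hz
    exact ⟨ρ, range_subset_iff.2 hρ⟩
  refine IsCoveringMap.mk _ (fun x => proj H ⁻¹' {x}) (fun x =>
    IsOpen.trivializationDiscrete (fun i => sheet H (r x i) (V x)) (V x) (hV x) ?_ ?_ ?_ ?_ ?_) hxV
  · intro i W hW
    refine ⟨fun h => (h.preimage continuous_proj).inter (isOpen_sheet _ (hV x)), fun h => ?_⟩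
    rw [isOpen_iff_mem_nhds]
    intro z hz
    obtain ⟨ρ, hρ⟩ := hpath x z (hW hz)
    obtain ⟨U, hU, hUs⟩ := h z ((r x i).trans ρ) ⟨hz, z, ρ, hρ, rfl⟩
    refine Filter.mem_of_superset (pathComponentIn_mem_nhds hU) ?_
    rintro w ⟨τ, hτ⟩
    exact (hUs w τ (range_subset_iff.2 hτ)).1
  · rintro i _ ⟨z, ρ, hρ, rfl⟩ _ ⟨z', ρ', hρ', rfl⟩ h
    obtain rfl : z = z' := h
    exact (mk_trans_eq_of_absorbs (hVH x) ρ ρ' hρ hρ').2 rfl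
  · intro i z hz
    obtain ⟨ρ, hρ⟩ := hpath x z hz
    exact ⟨_, ⟨z, ρ, hρ, rfl⟩, rfl⟩
  · intro i j hij
    refine Set.disjoint_left.2 ?_
    rintro _ ⟨z, ρ, hρ, rfl⟩ ⟨z', ρ', hρ', h⟩
    obtain rfl : z = z' := congrArg (proj H) h
    refine hij (Subtype.ext ?_)
    rw [hr, hr]
    exact (mk_trans_eq_of_absorbs (hVH x) ρ ρ' hρ hρ').1 h
  · intro w hw
    obtain ⟨z, b, rfl⟩ := exists_rep w
    obtain ⟨ρ, hρ⟩ := hpath x z hw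
    refine mem_iUnion.2 ⟨⟨mk H (b.trans ρ.symm), rfl⟩, z, ρ, hρ, ?_⟩
    rw [← mk_trans_symm_trans b ρ, mk_trans_eq_mk_trans_iff]
    exact hr x ⟨mk H (b.trans ρ.symm), rfl⟩

/-- By uniqueness of lifts in a covering, a loop upstairs is the canonical lift of its projection,
so that projection has trivial class modulo `H`. -/
theorem range_projMap_of_absorbs [PathConnectedSpace X] [LocallyPathConnectedSpace X]
    (hH : AbsorbsSmallLoops H) :
    (FundamentalGroup.mapOfEq (projMap H) (projMap_mk_refl H)).range = H := by
  refine le_antisymm ?_ le_range_projMap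
  rintro _ ⟨g, rfl⟩
  obtain ⟨η, rfl⟩ := Path.Homotopic.Quotient.mk_surjective g
  let γ : Path x₀ x₀ := η.map (projMap H).continuous
  have h₁ : ⇑(liftPath H γ) = ⇑η := by
    refine (isCoveringMap_proj hH).eq_of_comp_eq (liftPath H γ).continuous η.continuous ?_ 0 ?_
    · rfl
    · rw [Path.source, Path.source]
  have h₂ : mk H γ = mk H (Path.refl x₀) := by
    rw [← (liftPath H γ).target, h₁, η.target]
  rw [mk_eq_mk_iff, loopClass_refl] at h₂
  rw [FundamentalGroup.mapOfEq_apply]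
  exact h₂

end WhiskerSpace

end

/-! ### Lifted loops and the image of the fundamental group. -/

section lifts

variable {X E : Type u} [TopologicalSpace X] [TopologicalSpace E] {p : C(E, X)}

theorem Path.apply_trans_eq_trans_apply {e₀ e₁ e₂ : E} {x₀ x₁ x₂ : X}
    {a : Path e₀ e₁} {b : Path e₁ e₂}
    {α : Path x₀ x₁} {β : Path x₁ x₂} (ha : ∀ t, p (a t) = α t) (hb : ∀ t, p (b t) = β t) (t : I) :
    p (a.trans b t) = α.trans β t := by
  rw [Path.trans_apply, Path.trans_apply]
  split_ifs
  · exact ha _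
  · exact hb _

theorem FundamentalGroup.mk_mem_range_mapOfEq {e₀ : E} {x₀ : X} (hp : p e₀ = x₀)
    {γ : Path x₀ x₀} (η : Path e₀ e₀) (h : ∀ t, p (η t) = γ t) :
    (Path.Homotopic.Quotient.mk γ : FundamentalGroup X x₀) ∈
      (FundamentalGroup.mapOfEq p hp).range := by
  refine ⟨Path.Homotopic.Quotient.mk η, ?_⟩
  rw [FundamentalGroup.mapOfEq_apply]
  have : (η.map p.continuous).cast hp.symm hp.symm = γ := Path.ext (funext h)
  rw [← this]
  rfl

theorem FundamentalGroup.exists_path_of_mem_range_mapOfEq {e₀ : E} {x₀ : X} {hp : p e₀ = x₀}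
    {g : FundamentalGroup X x₀} (hg : g ∈ (FundamentalGroup.mapOfEq p hp).range) :
    ∃ (η : Path e₀ e₀) (γ : Path x₀ x₀), g = Path.Homotopic.Quotient.mk γ ∧
      ∀ t, p (η t) = γ t := by
  obtain ⟨k, rfl⟩ := hg
  obtain ⟨η, rfl⟩ := Path.Homotopic.Quotient.mk_surjective k
  refine ⟨η, (η.map p.continuous).cast hp.symm hp.symm, ?_, fun t => rfl⟩
  rw [FundamentalGroup.mapOfEq_apply]
  rfl

end lifts

/-! ### From covering subgroups to a generalized covering. -/

section

open WhiskerSpace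

variable {X : Type u} [TopologicalSpace X] {x₀ : X}

theorem IsCoveringMap.absorbsSmallLoops {E : Type u} [TopologicalSpace E] {p : C(E, X)} {e₀ : E}
    (hp : p e₀ = x₀) (cov : IsCoveringMap p) :
    AbsorbsSmallLoops (FundamentalGroup.mapOfEq p hp).range := by
  intro x
  obtain ⟨_, V, hxV, hV, _, φ, hφ⟩ := cov x
  refine ⟨V, hV.mem_nhds hxV, fun α β hβ => ?_⟩
  obtain ⟨Γ, hΓ, hΓ₀⟩ := cov.exists_path_lifts α.toContinuousMap e₀ (by simp [hp])
  have hΓ' : ∀ t, p (Γ t) = α t := fun t => congrFun hΓ t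
  have hx : p (Γ 1) = x := by rw [hΓ', α.target]
  let e : p ⁻¹' V := ⟨Γ 1, by rw [mem_preimage, hx]; exact hxV⟩
  let a : Path e₀ (Γ 1) := ⟨Γ, hΓ₀, rfl⟩
  have hβV : ∀ t, β t ∈ V := fun t => hβ ⟨t, rfl⟩
  have hend : (φ.symm (⟨x, hxV⟩, (φ e).2) : E) = Γ 1 := by
    have : ((⟨x, hxV⟩ : V), (φ e).2) = φ e := by
      refine Prod.ext (Subtype.ext ?_) rfl
      rw [hφ]
      exact hx.symm
    rw [this, φ.symm_apply_apply]
  -- Over the trivialized `V`, the lift of `β` keeps its fibre coordinate fixed, so it closes up.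
  let b : Path (Γ 1) (Γ 1) :=
    { toFun := fun t => φ.symm (⟨β t, hβV t⟩, (φ e).2)
      continuous_toFun := by fun_prop
      source' := by simp only [β.source, hend]
      target' := by simp only [β.target, hend] }
  have hb : ∀ t, p (b t) = β t := fun t => by
    change p (φ.symm (⟨β t, hβV t⟩, (φ e).2)) = β t
    rw [← hφ, φ.apply_symm_apply]
  have := FundamentalGroup.mk_mem_range_mapOfEq hp (γ := (α.trans β).trans α.symm)
    ((a.trans b).trans a.symm)
    (Path.apply_trans_eq_trans_apply (Path.apply_trans_eq_trans_apply hΓ' hb) fun t => hΓ' _)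
  rwa [Path.Homotopic.Quotient.mk_trans, Path.Homotopic.Quotient.mk_symm] at this

namespace WhiskerSpace

variable {H : Subgroup (FundamentalGroup X x₀)}

theorem isCoveringSubgroup [PathConnectedSpace X] [LocallyPathConnectedSpace X]
    (hH : AbsorbsSmallLoops H) : IsCoveringSubgroup x₀ H :=
  ⟨WhiskerSpace H, inferInstance, projMap H, mk H (Path.refl x₀), projMap_mk_refl H,
    inferInstance, isCoveringMap_proj hH, range_projMap_of_absorbs hH⟩

/-- A point of `Y` goes to the class of the image of any path to it from `y₀`; two choices differ by
the image of a loop, which lies in `H`. -/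
theorem exists_continuous_lift {Y : Type u} [TopologicalSpace Y] [PathConnectedSpace Y]
    [LocallyPathConnectedSpace Y] {y₀ : Y} (f : C(Y, X)) (hf : f y₀ = x₀)
    (hle : (FundamentalGroup.mapOfEq f hf).range ≤ H) :
    ∃ g : C(Y, WhiskerSpace H), g y₀ = mk H (Path.refl x₀) ∧ (projMap H).comp g = f := by
  let push {y : Y} (c : Path y₀ y) : Path x₀ (f y) := (c.map f.continuous).cast hf.symm rfl
  have hpush {y : Y} (c d : Path y₀ y) : mk H (push c) = mk H (push d) := by
    rw [mk_eq_mk_iff]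
    refine hle ?_
    have := FundamentalGroup.mk_mem_range_mapOfEq hf (γ := (push c).trans (push d).symm)
      (c.trans d.symm) (Path.apply_trans_eq_trans_apply (fun _ => rfl) fun _ => rfl)
    rwa [Path.Homotopic.Quotient.mk_trans, Path.Homotopic.Quotient.mk_symm] at this
  let g (y : Y) : WhiskerSpace H := mk H (push (PathConnectedSpace.somePath y₀ y))
  have hg {y : Y} (c : Path y₀ y) : g y = mk H (push c) := hpush _ _
  refine ⟨⟨g, ⟨fun s hs => ?_⟩⟩, ?_, ?_⟩
  · rw [isOpen_iff_mem_nhds]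
    intro y hy
    obtain ⟨U, hU, hUs⟩ := hs _ _ hy
    refine Filter.mem_of_superset
      (pathComponentIn_mem_nhds (f.continuous.continuousAt.preimage_mem_nhds hU)) ?_
    rintro w ⟨τ, hτ⟩
    have h := hUs _ (τ.map f.continuous) (range_subset_iff.2 hτ)
    rw [mem_preimage, hg ((PathConnectedSpace.somePath y₀ y).trans τ)]
    convert h using 2
    refine Path.ext (funext fun t => ?_)
    exact Path.apply_trans_eq_trans_apply (p := f) (fun _ => rfl) (fun _ => rfl) t
  · change g y₀ = _
    rw [hg (Path.refl y₀)]
    exact mk_eq_mk_refl _ fun _ => hf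
  · rfl

theorem isGeneralizedCovering_of_eq_sInf [PathConnectedSpace X] [LocallyPathConnectedSpace X]
    {S : Set (Subgroup (FundamentalGroup X x₀))} (hS : ∀ K ∈ S, AbsorbsSmallLoops K)
    (hHS : H = sInf S) :
    IsGeneralizedCovering (projMap H) (mk H (Path.refl x₀)) x₀ (projMap_mk_refl H) ∧
      (FundamentalGroup.mapOfEq (projMap H) (projMap_mk_refl H)).range = H := by
  have hle : ∀ K ∈ S, H ≤ K := fun K hK => hHS ▸ sInf_le hK
  have hrange : (FundamentalGroup.mapOfEq (projMap H) (projMap_mk_refl H)).range = H := by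
    refine le_antisymm (fun g hg => ?_) le_range_projMap
    obtain ⟨η, γ, rfl, hη⟩ := FundamentalGroup.exists_path_of_mem_range_mapOfEq hg
    rw [hHS, Subgroup.mem_sInf]
    intro K hK
    rw [← range_projMap_of_absorbs (hS K hK)]
    refine FundamentalGroup.mk_mem_range_mapOfEq _ (η.map (continuous_map (hle K hK))) fun t => ?_
    exact (proj_map (hle K hK) _).trans (hη t)
  refine ⟨⟨inferInstance, inferInstance, ?_⟩, hrange⟩
  intro Y _ _ _ y₀ f hf hfH
  have : PathConnectedSpace Y := .of_locallyPathConnectedSpace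
  obtain ⟨g, hg₀, hg⟩ := exists_continuous_lift f hf (hfH.trans hrange.le)
  refine ⟨g, ⟨hg₀, hg⟩, ?_⟩
  rintro g' ⟨hg'₀, hg'⟩
  ext y
  obtain ⟨a, ha⟩ := exists_rep_of_proj (DFunLike.congr_fun hg y)
  obtain ⟨b, hb⟩ := exists_rep_of_proj (DFunLike.congr_fun hg' y)
  -- Equality modulo `H` is equality modulo every `K` in `S`, where uniqueness of lifts in a
  -- covering applies.
  rw [ha, hb, mk_eq_mk_iff, hHS, Subgroup.mem_sInf]
  intro K hK
  rw [← mk_eq_mk_iff, ← map_mk (hle K hK), ← map_mk (hle K hK), ← ha, ← hb]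
  refine congrFun ((isCoveringMap_proj (hS K hK)).eq_of_comp_eq
    ((continuous_map (hle K hK)).comp g'.continuous)
    ((continuous_map (hle K hK)).comp g.continuous) ?_ y₀ ?_) y
  · funext z
    simp only [Function.comp_apply, proj_map]
    exact (DFunLike.congr_fun hg' z).trans (DFunLike.congr_fun hg z).symm
  · simp only [Function.comp_apply, hg₀, hg'₀]

end WhiskerSpace

end

/-! ### The comb of a family of paths. -/

/-- A family of arcs glued together at their starting points, with a topology that makes the arcs
shrink towards the starting point as fast as their images under the paths `γ i`. The starting
points are not identified, but topologically indistinguishable. -/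
def Comb {X : Type u} [TopologicalSpace X] {x y : X} {ι : Type u} (_ : ι → Path x y) : Type u :=
  ι × I

namespace Comb

variable {X : Type u} [TopologicalSpace X] {x y : X} {ι : Type u} {γ : ι → Path x y}

/-- The point of parameter `t` on the arc of index `i`. -/
def mk (γ : ι → Path x y) (i : ι) (t : I) : Comb γ := (i, t)

/-- The whole initial piece of the arc up to `t` must map into `U`, not only its end. This makes the
basic neighbourhoods of the starting points star-shaped. -/
instance : TopologicalSpace (Comb γ) where
  IsOpen s := (∀ i, IsOpen {t | mk γ i t ∈ s}) ∧ ∀ i, mk γ i 0 ∈ s →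
    ∃ U ∈ 𝓝 x, ∀ j t, (∀ r, γ j (r * t) ∈ U) → mk γ j t ∈ s
  isOpen_univ := ⟨fun _ => isOpen_univ, fun _ _ => ⟨univ, univ_mem, fun _ _ _ => mem_univ _⟩⟩
  isOpen_inter s t hs ht := by
    refine ⟨fun i => (hs.1 i).inter (ht.1 i), fun i hi => ?_⟩
    obtain ⟨U, hU, h⟩ := hs.2 i hi.1
    obtain ⟨V, hV, h'⟩ := ht.2 i hi.2
    exact ⟨U ∩ V, inter_mem hU hV, fun j t hj =>
      ⟨h j t fun r => (hj r).1, h' j t fun r => (hj r).2⟩⟩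
  isOpen_sUnion S hS := by
    refine ⟨fun i => ?_, fun i hi => ?_⟩
    · have : {t | mk γ i t ∈ ⋃₀ S} = ⋃ s ∈ S, {t | mk γ i t ∈ s} := by
        ext t
        simp
      rw [this]
      exact isOpen_biUnion fun s hs => (hS s hs).1 i
    · obtain ⟨s, hs, hi⟩ := hi
      obtain ⟨U, hU, h⟩ := (hS s hs).2 i hi
      exact ⟨U, hU, fun j t hj => ⟨s, hs, h j t hj⟩⟩

theorem isOpen_iff {s : Set (Comb γ)} :
    IsOpen s ↔ (∀ i, IsOpen {t | mk γ i t ∈ s}) ∧ ∀ i, mk γ i 0 ∈ s →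
      ∃ U ∈ 𝓝 x, ∀ j t, (∀ r, γ j (r * t) ∈ U) → mk γ j t ∈ s :=
  Iff.rfl

theorem continuous_mk (i : ι) : Continuous (mk γ i) :=
  ⟨fun _ hs => hs.1 i⟩

/-- The map to `X` given by the paths `γ i`. -/
def toSpace (γ : ι → Path x y) : C(Comb γ, X) where
  toFun z := γ z.1 z.2
  continuous_toFun := by
    refine ⟨fun W hW => ⟨fun i => hW.preimage (γ i).continuous, fun i hi => ?_⟩⟩
    refine ⟨W, hW.mem_nhds ?_, fun j t hj => ?_⟩
    · have : γ i 0 ∈ W := hi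
      rwa [(γ i).source] at this
    · have := hj 1
      rwa [one_mul] at this

theorem toSpace_mk (i : ι) (t : I) : toSpace γ (mk γ i t) = γ i t := rfl

theorem mk_zero_mem_of_isOpen {s : Set (Comb γ)} (hs : IsOpen s) {i : ι} (hi : mk γ i 0 ∈ s)
    (j : ι) : mk γ j 0 ∈ s := by
  obtain ⟨U, hU, h⟩ := hs.2 i hi
  refine h j 0 fun r => ?_
  rw [mul_zero, (γ j).source]
  exact mem_of_mem_nhds hU

theorem inseparable_mk_zero (i j : ι) : Inseparable (mk γ i 0) (mk γ j 0) :=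
  inseparable_iff_forall_isOpen.2 fun _ hs =>
    ⟨fun h => mk_zero_mem_of_isOpen hs h j, fun h => mk_zero_mem_of_isOpen hs h i⟩

/-- The points that are joined to the start of their arc within the preimage of `U`. -/
def star (γ : ι → Path x y) (U : Set X) : Set (Comb γ) :=
  {z | ∀ r : I, γ z.1 (r * z.2) ∈ U}

theorem isOpen_star {U : Set X} (hU : IsOpen U) : IsOpen (star γ U) := by
  refine isOpen_iff.2 ⟨fun i => ?_, fun i hi => ⟨U, hU.mem_nhds ?_, fun j t h => h⟩⟩
  · have : {t | mk γ i t ∈ star γ U}ᶜ = Prod.snd '' {q : I × I | γ i (q.1 * q.2) ∈ Uᶜ} := by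
      ext t
      constructor
      · intro ht
        obtain ⟨r, hr⟩ := not_forall.1 ht
        exact ⟨(r, t), hr, rfl⟩
      · rintro ⟨⟨r, t'⟩, hr, rfl⟩ h
        exact hr (h r)
    rw [← isClosed_compl_iff, this]
    -- The bad parameters are the projection of a closed set along the compact factor of the `r`.
    refine isClosedMap_snd_of_compactSpace _ (hU.isClosed_compl.preimage ?_)
    fun_prop
  · have := hi 1
    simpa [mk] using this

/-- Near a starting point, stars are stable under scaling; elsewhere the comb is locally a single
arc. -/
theorem continuous_mul : Continuous fun q : I × Comb γ => mk γ q.2.1 (q.1 * q.2.2) := by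
  refine continuous_def.2 fun s hs => isOpen_iff_mem_nhds.2 ?_
  rintro ⟨r₀, z₀⟩ hz
  have hz : mk γ z₀.1 (r₀ * z₀.2) ∈ s := hz
  by_cases ht : z₀.2 = 0
  · rw [ht, mul_zero] at hz
    obtain ⟨U, hU, h⟩ := hs.2 _ hz
    obtain ⟨V, hVU, hV, hxV⟩ := mem_nhds_iff.1 hU
    have hz₀ : z₀ ∈ star γ V := fun r => by
      rw [ht, mul_zero, (γ _).source]
      exact hxV
    filter_upwards [prod_mem_nhds univ_mem ((isOpen_star hV).mem_nhds hz₀)]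
    rintro ⟨r, z⟩ ⟨-, hz⟩
    refine h _ _ fun r' => hVU ?_
    rw [← mul_assoc]
    exact hz _
  · have hA : {q : I × I | mk γ z₀.1 (q.1 * q.2) ∈ s} ∈ 𝓝 (r₀, z₀.2) :=
      (hs.preimage ((continuous_mk z₀.1).comp (_root_.continuous_mul (M := I)))).mem_nhds hz
    obtain ⟨R, hR, T, hT, hRT⟩ := mem_nhds_prod_iff.1 hA
    obtain ⟨T', hTT', hT', htT'⟩ := mem_nhds_iff.1 hT
    have hopen : IsOpen {z : Comb γ | z.1 = z₀.1 ∧ z.2 ∈ T' ∧ z.2 ≠ 0} := by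
      refine isOpen_iff.2 ⟨fun i => ?_, fun i hi => absurd rfl hi.2.2⟩
      by_cases hi : i = z₀.1
      · have : {t | mk γ i t ∈ {z : Comb γ | z.1 = z₀.1 ∧ z.2 ∈ T' ∧ z.2 ≠ 0}} = T' ∩ {0}ᶜ :=
          Set.ext fun t => ⟨fun h => h.2, fun h => ⟨hi, h⟩⟩
        rw [this]
        exact hT'.inter isOpen_compl_singleton
      · have : {t | mk γ i t ∈ {z : Comb γ | z.1 = z₀.1 ∧ z.2 ∈ T' ∧ z.2 ≠ 0}} = ∅ :=
          Set.ext fun t => ⟨fun h => hi h.1, fun h => h.elim⟩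
        rw [this]
        exact isOpen_empty
    filter_upwards [prod_mem_nhds hR (hopen.mem_nhds ⟨rfl, htT', ht⟩)]
    rintro ⟨r, i, t⟩ ⟨hr, hi, ht, -⟩
    obtain rfl : i = z₀.1 := hi
    exact hRT (mk_mem_prod hr (hTT' ht))

instance [Nonempty ι] : ContractibleSpace (Comb γ) := by
  classical
  let i₀ : ι := Classical.arbitrary ι
  rw [contractible_iff_id_nullhomotopic]
  refine ⟨mk γ i₀ 0, ⟨ContinuousMap.Homotopy.symm
    -- Scaling to `0` ends at a different starting point on each arc. Replacing them all by one
    -- keeps continuity, as they are inseparable.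
    { toFun := fun q => if q.1 = 0 then mk γ i₀ 0 else mk γ q.2.1 (q.1 * q.2.2)
      continuous_toFun := ?_
      map_zero_left := fun z => if_pos rfl
      map_one_left := fun z => ?_ }⟩⟩
  · refine (continuous_congr_of_inseparable fun q => ?_).2 (continuous_mul (γ := γ))
    split_ifs with h
    · rw [h, zero_mul]
      exact inseparable_mk_zero _ _
    · rfl
  · simp only [one_ne_zero, if_false, one_mul]
    rfl

theorem joinedIn_mk_zero {s : Set (Comb γ)} {i : ι} {t : I}
    (h : ∀ r : I, mk γ i (r * t) ∈ s) : JoinedIn s (mk γ i 0) (mk γ i t) := by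
  refine ⟨⟨⟨fun r => mk γ i (r * t), (continuous_mk i).comp (by fun_prop)⟩, ?_, ?_⟩, h⟩
  · simp
  · simp

instance : LocallyPathConnectedSpace (Comb γ) := by
  rw [locallyPathConnectedSpace_iff_isOpen_pathComponentIn]
  intro z s hs
  refine isOpen_iff.2 ⟨fun i => isOpen_iff_mem_nhds.2 fun t ht => ?_, fun i hi => ?_⟩
  · have hts : mk γ i t ∈ s := ht.target_mem
    have hN : {r | mk γ i r ∈ s} ∈ 𝓝 t := (hs.1 i).mem_nhds hts
    refine Filter.mem_of_superset (pathComponentIn_mem_nhds hN) fun r hr => ?_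
    refine JoinedIn.trans ht ?_
    obtain ⟨c, hc⟩ := hr
    exact ⟨c.map (continuous_mk i), hc⟩
  · have his : mk γ i 0 ∈ s := hi.target_mem
    obtain ⟨U, hU, h⟩ := hs.2 i his
    refine ⟨U, hU, fun j t hj => ?_⟩
    refine hi.trans (((inseparable_mk_zero i j).joinedIn his
      (mk_zero_mem_of_isOpen hs his j)).trans (joinedIn_mk_zero fun r => h _ _ fun r' => ?_))
    rw [← mul_assoc]
    exact hj _

end Comb

/-! ### Path and homotopy lifting for generalized coverings. -/

section

variable {X E : Type u} [TopologicalSpace X] [TopologicalSpace E] {p : C(E, X)} {e₀ : E} {x₀ : X}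
  {hp : p e₀ = x₀}

instance unitInterval.contractibleSpace : ContractibleSpace I :=
  (convex_Icc 0 1).contractibleSpace ⟨0, unitInterval.zero_mem⟩

namespace IsGeneralizedCovering

theorem existsUnique_lift (h : IsGeneralizedCovering p e₀ x₀ hp) {Y : Type u} [TopologicalSpace Y]
    [SimplyConnectedSpace Y] [LocallyPathConnectedSpace Y] {y₀ : Y} (f : C(Y, X))
    (hf : f y₀ = x₀) : ∃! g : C(Y, E), g y₀ = e₀ ∧ p.comp g = f := by
  refine h.uniqueLifting Y y₀ f hf ?_
  rintro _ ⟨k, rfl⟩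
  rw [Subsingleton.elim k 1, map_one]
  exact one_mem _

theorem existsUnique_lift_of_contractible (h : IsGeneralizedCovering p e₀ x₀ hp) {Y : Type}
    [TopologicalSpace Y] [ContractibleSpace Y] [LocallyPathConnectedSpace Y] {y₀ : Y}
    (f : C(Y, X)) (hf : f y₀ = x₀) : ∃! g : C(Y, E), g y₀ = e₀ ∧ p.comp g = f := by
  have : ContractibleSpace (ULift.{u} Y) := Homeomorph.ulift.contractibleSpace
  have : LocallyPathConnectedSpace (ULift.{u} Y) :=
    Homeomorph.ulift.isOpenEmbedding.locallyPathConnectedSpace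
  let up : C(Y, ULift.{u} Y) := ⟨ULift.up, continuous_uliftUp⟩
  let down : C(ULift.{u} Y, Y) := ⟨ULift.down, continuous_uliftDown⟩
  obtain ⟨g, ⟨hg₀, hg⟩, huniq⟩ := h.existsUnique_lift (y₀ := ULift.up y₀) (f.comp down) hf
  refine ⟨g.comp up, ⟨hg₀, ?_⟩, ?_⟩
  · rw [← ContinuousMap.comp_assoc, hg]
    rfl
  · rintro g' ⟨hg'₀, hg'⟩
    rw [← huniq (g'.comp down) ⟨hg'₀, by rw [← ContinuousMap.comp_assoc, hg']⟩]
    rfl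

theorem eq_of_comp_eq_of_base (h : IsGeneralizedCovering p e₀ x₀ hp) {η θ : C(I, E)} (hη : η 0 = e₀)
    (hθ : θ 0 = e₀) (hpr : ∀ t, p (η t) = p (θ t)) : η = θ :=
  (h.existsUnique_lift_of_contractible (y₀ := (0 : I)) (p.comp θ) (by simp [hθ, hp])).unique
    ⟨hη, ContinuousMap.ext hpr⟩ ⟨hθ, rfl⟩

theorem pathConnectedSpace (h : IsGeneralizedCovering p e₀ x₀ hp) : PathConnectedSpace E :=
  have := h.connectedSpace
  have := h.locallyPathConnectedSpace
  .of_locallyPathConnectedSpace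

/-- Unique lifting is given only at `e₀`; a common path from `e₀` is prepended to both. -/
theorem eq_of_comp_eq (h : IsGeneralizedCovering p e₀ x₀ hp) {η θ : C(I, E)} (h₀ : η 0 = θ 0)
    (hpr : ∀ t, p (η t) = p (θ t)) : η = θ := by
  have := h.pathConnectedSpace
  let c : Path e₀ (η 0) := PathConnectedSpace.somePath _ _
  let a : Path e₀ (η 1) := c.trans ⟨η, rfl, rfl⟩
  let b : Path e₀ (θ 1) := c.trans ⟨θ, h₀.symm, rfl⟩
  have hab : ∀ t, p (a t) = p (b t) := fun t => by
    simp only [a, b, Path.trans_apply]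
    split_ifs
    · rfl
    · exact hpr _
  have key := h.eq_of_comp_eq_of_base (η := a.toContinuousMap) (θ := b.toContinuousMap)
    a.source b.source hab
  ext t
  -- The time at which the concatenation has reached parameter `t` of its second half.
  have ht : (1 + (t : ℝ)) / 2 ∈ I := ⟨by linarith [t.2.1], by linarith [t.2.2]⟩
  have key' := DFunLike.congr_fun key ⟨_, ht⟩
  change a _ = b _ at key'
  simp only [a, b, Path.trans_apply] at key'
  split_ifs at key' with ht'
  · have ht₀ : t = 0 := Subtype.ext (by
      have := t.2.1
      change (t : ℝ) = 0
      linarith)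
    rw [ht₀, h₀]
  · have h2 : 2 * ((1 + (t : ℝ)) / 2) - 1 = t := by ring
    simpa only [h2] using! key'

/-- Topologically comparable points in the same fibre are equal. -/
theorem eq_of_specializes (h : IsGeneralizedCovering p e₀ x₀ hp) {e e' : E} (hs : e ⤳ e')
    (he : p e = p e') : e = e' := by
  classical
  -- A path that jumps from `e` to `e'` at time `1` is continuous because `e ⤳ e'`, and has the same
  -- projection as the constant path.
  let η : C(I, E) := ⟨({1} : Set I).piecewise (fun _ => e') fun _ => e,
    isClosed_singleton.continuous_piecewise_of_specializes continuous_const continuous_const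
      fun _ => hs⟩
  have key : η = ContinuousMap.const I e := by
    refine h.eq_of_comp_eq (by simp [η]) fun t => ?_
    by_cases ht : t = 1 <;> simp [η, ht, he]
  simpa [η] using (DFunLike.congr_fun key 1).symm

/-- The homotopy square lifts, and its two sides over the fixed endpoints lift constant paths, so
they are constant. -/
theorem apply_one_eq_of_homotopic (h : IsGeneralizedCovering p e₀ x₀ hp) {x : X} {α β : Path x₀ x}
    (hαβ : α.Homotopic β) {e e' : E} {a : Path e₀ e} {b : Path e₀ e'} (ha : ∀ t, p (a t) = α t)
    (hb : ∀ t, p (b t) = β t) : e = e' := by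
  obtain ⟨F⟩ := hαβ
  obtain ⟨G, ⟨hG₀, hG⟩, -⟩ := h.existsUnique_lift_of_contractible (y₀ := ((0, 0) : I × I))
    F.toContinuousMap (F.source 0)
  have hG' : ∀ s t, p (G (s, t)) = F (s, t) := fun s t => DFunLike.congr_fun hG (s, t)
  let side (t : I) : C(I, E) := ⟨fun s => G (s, t), by fun_prop⟩
  let row (s : I) : C(I, E) := ⟨fun t => G (s, t), by fun_prop⟩
  have h₀ : side 0 = ContinuousMap.const I (G (0, 0)) := h.eq_of_comp_eq rfl fun s => by
    simp [side, hG']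
  have h₁ : side 1 = ContinuousMap.const I (G (0, 1)) := h.eq_of_comp_eq rfl fun s => by
    simp [side, hG']
  have ha' : row 0 = a.toContinuousMap :=
    h.eq_of_comp_eq_of_base hG₀ a.source fun t => by
      simp [row, hG', ha]
  have hb' : row 1 = b.toContinuousMap :=
    h.eq_of_comp_eq_of_base ((DFunLike.congr_fun h₀ 1).trans hG₀) b.source fun t => by
      simp [row, hG', hb]
  calc e = row 0 1 := by rw [ha']; exact a.target.symm
    _ = row 1 1 := (DFunLike.congr_fun h₁ 1).symm
    _ = e' := by rw [hb']; exact b.target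

theorem exists_lift_path (h : IsGeneralizedCovering p e₀ x₀ hp) {x : X} (α : Path x₀ x) :
    ∃ (e : E) (a : Path e₀ e), ∀ t, p (a t) = α t := by
  obtain ⟨g, ⟨hg₀, hg⟩, -⟩ := h.existsUnique_lift_of_contractible (y₀ := (0 : I))
    α.toContinuousMap α.source
  exact ⟨g 1, ⟨g, hg₀, rfl⟩, DFunLike.congr_fun hg⟩

/-- A point of the fibre over `x₀` that can be reached from `e₀` by lifts of arbitrarily small
loops is `e₀`. -/
theorem eq_of_small_paths (h : IsGeneralizedCovering p e₀ x₀ hp) {e₁ : E} (he₁ : p e₁ = x₀)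
    (hsmall : ∀ U ∈ 𝓝 x₀, ∃ η : Path e₀ e₁, ∀ t, p (η t) ∈ U) : e₁ = e₀ := by
  let γ (η : Path e₀ e₁) : Path x₀ x₀ := (η.map p.continuous).cast hp.symm he₁.symm
  obtain ⟨η₀, -⟩ := hsmall univ univ_mem
  have : Nonempty (Path e₀ e₁) := ⟨η₀⟩
  -- The comb is indexed by all paths from `e₀` to `e₁`; by uniqueness `g` restricts to `η` on the
  -- arc of index `η`.
  obtain ⟨g, ⟨hg₀, hg⟩, -⟩ := h.existsUnique_lift (y₀ := Comb.mk γ η₀ 0) (Comb.toSpace γ)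
    ((Comb.toSpace_mk _ _).trans (γ η₀).source)
  have hstart : ∀ η, g (Comb.mk γ η 0) = e₀ := fun η => by
    have hs := ((Comb.inseparable_mk_zero η η₀).map g.continuous).specializes
    rw [hg₀] at hs
    refine h.eq_of_specializes hs ?_
    exact (DFunLike.congr_fun hg _).trans ((γ η).source.trans hp.symm)
  have hend : ∀ η, g (Comb.mk γ η 1) = e₁ := fun η => by
    have key : g.comp ⟨Comb.mk γ η, Comb.continuous_mk η⟩ = η.toContinuousMap :=
      h.eq_of_comp_eq_of_base (hstart η) η.source fun t => DFunLike.congr_fun hg (Comb.mk γ η t)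
    exact (DFunLike.congr_fun key 1).trans η.target
  refine h.eq_of_specializes (specializes_iff_forall_open.2 fun W hW he₀ => ?_) (he₁.trans hp.symm)
  have hz : g (Comb.mk γ η₀ 0) ∈ W := by rwa [hg₀]
  -- An open set around `e₀` pulls back to one containing every arc that maps into some `U`; the far
  -- end of such an arc goes to `e₁`.
  obtain ⟨U, hU, hUW⟩ := (hW.preimage g.continuous).2 η₀ hz
  obtain ⟨η, hη⟩ := hsmall U hU
  have := hUW η 1 fun r => hη _
  rwa [mem_preimage, hend] at this

end IsGeneralizedCovering

/-! ### From a generalized covering to covering subgroups. -/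

/-- The subgroup of `π₁(X, x₀)` of the classes of loops in `U`. -/
def smallLoopSubgroup (x₀ : X) {U : Set X} (hU : x₀ ∈ U) : Subgroup (FundamentalGroup X x₀) where
  carrier := {g | ∃ γ : Path x₀ x₀, range γ ⊆ U ∧ g = Path.Homotopic.Quotient.mk γ}
  one_mem' := ⟨Path.refl x₀, by simpa using hU, rfl⟩
  mul_mem' := by
    rintro _ _ ⟨γ, hγ, rfl⟩ ⟨δ, hδ, rfl⟩
    exact ⟨δ.trans γ, by rw [Path.trans_range]; exact union_subset hδ hγ, rfl⟩
  inv_mem' := by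
    rintro _ ⟨γ, hγ, rfl⟩
    exact ⟨γ.symm, by rwa [Path.symm_range], rfl⟩

open WhiskerSpace

theorem StrongSLTAt.absorbsSmallLoops (hX : StrongSLTAt X x₀) {U : Set X} (hU : U ∈ 𝓝 x₀) :
    AbsorbsSmallLoops (smallLoopSubgroup x₀ (mem_of_mem_nhds hU)).normalCore := by
  intro x
  obtain ⟨V, hV, h⟩ := hX x U hU
  refine ⟨V, hV, fun α β hβ g => ?_⟩
  obtain ⟨c, rfl⟩ := Path.Homotopic.Quotient.mk_surjective g
  -- Conjugating by `c` only changes the connecting path `α`, and `V` is independent of that path;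
  -- hence the normal core still absorbs small loops.
  obtain ⟨γ, hγ, hγ'⟩ := h (c.symm.trans α) β hβ
  refine ⟨γ, hγ, ?_⟩
  rw [Path.Homotopic.Quotient.eq.2 hγ']
  simp only [FundamentalGroup.mul_def, FundamentalGroup.inv_def, loopClass,
    Path.Homotopic.Quotient.mk_trans, Path.Homotopic.Quotient.mk_symm,
    Path.Homotopic.Quotient.symm_trans_rev, Path.Homotopic.Quotient.symm_symm,
    Path.Homotopic.Quotient.trans_assoc]

theorem IsGeneralizedCovering.mem_range_of_forall_mem_sup (h : IsGeneralizedCovering p e₀ x₀ hp)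
    {g : FundamentalGroup X x₀}
    (hg : ∀ U (hU : U ∈ 𝓝 x₀), g ∈ (FundamentalGroup.mapOfEq p hp).range ⊔
      (smallLoopSubgroup x₀ (mem_of_mem_nhds hU)).normalCore) :
    g ∈ (FundamentalGroup.mapOfEq p hp).range := by
  obtain ⟨α, rfl⟩ := Path.Homotopic.Quotient.mk_surjective g
  obtain ⟨e₁, a, ha⟩ := h.exists_lift_path α
  have he₁ : p e₁ = x₀ := by rw [← a.target, ha, α.target]
  have key : e₁ = e₀ := by
    refine h.eq_of_small_paths he₁ fun U hU => ?_
    have := hg U hU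
    -- Normality splits the element as a product. Multiplication reverses concatenation, so with the
    -- normal factor on the left the loop `lam`, which lifts to a loop at `e₀`, is traversed first
    -- and the lift of `δ` runs from `e₀` to `e₁`.
    rw [sup_comm, Subgroup.mem_sup_of_normal_left] at this
    obtain ⟨n, hn, k, hk, hnk⟩ := this
    obtain ⟨δ, hδ, rfl⟩ := Subgroup.normalCore_le _ hn
    obtain ⟨l, lam, rfl, hl⟩ := FundamentalGroup.exists_path_of_mem_range_mapOfEq hk
    obtain ⟨e, d, hd⟩ := h.exists_lift_path δ
    have hhom : (lam.trans δ).Homotopic α := Path.Homotopic.Quotient.eq.1 hnk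
    obtain rfl : e = e₁ := h.apply_one_eq_of_homotopic hhom
      (a := l.trans d) (Path.apply_trans_eq_trans_apply hl hd) ha
    exact ⟨d, fun t => hd t ▸ hδ ⟨t, rfl⟩⟩
  subst key
  exact FundamentalGroup.mk_mem_range_mapOfEq hp a ha

end

theorem theorem41 (X : Type u) [TopologicalSpace X] [ConnectedSpace X] [LocallyPathConnectedSpace X]
    (x₀ : X) (hX : StrongSLTAt X x₀) (H : Subgroup (FundamentalGroup X x₀)) :
    (∃ (E : Type u) (_ : TopologicalSpace E) (p : C(E, X)) (e₀ : E) (hp : p e₀ = x₀),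
        IsGeneralizedCovering p e₀ x₀ hp ∧ (FundamentalGroup.mapOfEq p hp).range = H) ↔
      ∃ S : Set (Subgroup (FundamentalGroup X x₀)),
        S.Nonempty ∧ (∀ K ∈ S, IsCoveringSubgroup x₀ K) ∧ H = sInf S := by
  have : PathConnectedSpace X := .of_locallyPathConnectedSpace
  constructor
  · rintro ⟨E, _, p, e₀, hp, hE, rfl⟩
    refine ⟨range fun U : {U : Set X // U ∈ 𝓝 x₀} => (FundamentalGroup.mapOfEq p hp).range ⊔
      (smallLoopSubgroup x₀ (mem_of_mem_nhds U.2)).normalCore,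
      ⟨_, ⟨univ, univ_mem⟩, rfl⟩, ?_, le_antisymm ?_ fun g hg => ?_⟩
    · rintro _ ⟨U, rfl⟩
      exact WhiskerSpace.isCoveringSubgroup ((hX.absorbsSmallLoops U.2).mono le_sup_right)
    · refine le_sInf ?_
      rintro _ ⟨U, rfl⟩
      exact le_sup_left
    · exact hE.mem_range_of_forall_mem_sup fun U hU => Subgroup.mem_sInf.1 hg _ ⟨⟨U, hU⟩, rfl⟩
  · rintro ⟨S, -, hS, hH⟩
    refine ⟨WhiskerSpace H, inferInstance, WhiskerSpace.projMap H, _, _,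
      WhiskerSpace.isGeneralizedCovering_of_eq_sInf (fun K hK => ?_) hH⟩
    obtain ⟨E, _, p, e₀, hp, _, hcov, rfl⟩ := hS K hK
    exact hcov.absorbsSmallLoops hp
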